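/- Let $M$ be a field of characteristic $\neq 2$, and let $m,n\in M$ be such that the two cubics $X^3-mX^2-(m+3)X-1$ and $X^3-nX^2-(n+3)X-1$ are separable (equivalently, $(m^2+3m+9)(n^2+3n+9)\neq 0$). Then the splitting fields over $M$ of $X^3-mX^2-(m+3)X-1$ and of $X^3-nX^2-(n+3)X-1$, taken in a fixed algebraic closure of $M$, coincide if and only if there exists $z\in M$ with $mz(z+1)+z^3+3z^2-1\neq 0$ such that either $$n=\frac{m(z^3-3z-1)-9z(z+1)}{mz(z+1)+z^3+3z^2-1}\quad\text{or}\quad n=-\frac{m(z^3+3z^2-1)+3(z^3-3z-1)}{mz(z+1)+z^3+3z^2-1}.$$ -/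

import Mathlib

open Polynomial

/-- The Shanks cubic `X³ - m X² - (m + 3) X - 1` over a field `M`. -/
noncomputable def shanksCubic {M : Type*} [Field M] (m : M) : M[X] :=
  X ^ 3 - C m * X ^ 2 - C (m + 3) * X - 1

/-- The splitting field of `p` over `M` inside an extension `Ω` of `M` (used for an algebraic
closure `Ω`): the subfield of `Ω` generated over `M` by the roots of `p` in `Ω`. -/
noncomputable def splittingFieldIn {M : Type*} [Field M] (Ω : Type*) [Field Ω] [Algebra M Ω]
    (p : M[X]) : IntermediateField M Ω :=
  IntermediateField.adjoin M (p.rootSet Ω)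

/-! The Möbius map `σ x = -1 / (x + 1)` has order three and permutes the roots of every Shanks
cubic, so each root generates the splitting field. The law `x ∗ z = (x z - 1) / (x + z + 1)` is the
group law of a one-dimensional algebraic group, the projective line without the zeros of
`x² + x + 1`; in characteristic different from three and with `ω² + ω + 1 = 0`, the coordinate
`(x - ω) / (x - ω²)` turns it into multiplication. Its unit is `∞`, the inverse of `x` is `-1 - x`,
and `σ` is translation by `0`. The first formula of the theorem says that `x ∗ z` is a root for `n`
whenever `x` is a root for `m`, and the second is the first with `n` replaced by `-n - 3`, the
parameter whose roots are the reciprocals of the roots for `n`.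

If `n` is given by a formula, then `x` and `x ∗ z` generate the same field, as `z` lies in the base
field (`splittingFieldIn_eq_of_shanks_formula`). Conversely, suppose roots `x` and `y` generate the
same field. If that is the base field, the quotient `z` of `y` by `x` in the group lies in it.
Otherwise the cubics are irreducible, and an automorphism `τ` with `τ x = σ x` has `τ y = σ y` or
`τ y⁻¹ = σ y⁻¹`; as `σ` is a translation, `τ` fixes the quotient `z` of `y` (or `y⁻¹`) by `x`. The
field generated by `x` has prime degree three, so `z` lies in the base field
(`mem_range_of_fixed_of_shanks`). In all cases `z` satisfies the required formula
(`shanks_formula_of_quotient`). -/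

/-! ### Algebra of the roots -/

section Roots

variable {K : Type*} [Field K] {m n x y z : K}

theorem shanks_root_ne_zero (h : x ^ 3 - m * x ^ 2 - (m + 3) * x - 1 = 0) : x ≠ 0 := by
  rintro rfl
  simp at h

theorem shanks_root_add_one_ne_zero (h : x ^ 3 - m * x ^ 2 - (m + 3) * x - 1 = 0) :
    x + 1 ≠ 0 := by
  intro h1
  obtain rfl : x = -1 := by linear_combination h1
  exact one_ne_zero (α := K) (by linear_combination h)

theorem shanks_root_rotate (h : x ^ 3 - m * x ^ 2 - (m + 3) * x - 1 = 0) :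
    (-1 / (x + 1)) ^ 3 - m * (-1 / (x + 1)) ^ 2 - (m + 3) * (-1 / (x + 1)) - 1 = 0 := by
  have h1 := shanks_root_add_one_ne_zero h
  field_simp
  linear_combination -h

theorem shanks_root_inv (h : x ^ 3 - m * x ^ 2 - (m + 3) * x - 1 = 0) :
    (x⁻¹) ^ 3 - (-m - 3) * (x⁻¹) ^ 2 - (-m - 3 + 3) * x⁻¹ - 1 = 0 := by
  have h0 := shanks_root_ne_zero h
  field_simp
  linear_combination -h

theorem shanks_roots_eq (h : x ^ 3 - m * x ^ 2 - (m + 3) * x - 1 = 0)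
    (hy : y ^ 3 - m * y ^ 2 - (m + 3) * y - 1 = 0) :
    y = x ∨ y = -1 / (x + 1) ∨ y = -(x + 1) / x := by
  have h0 := shanks_root_ne_zero h
  have h1 := shanks_root_add_one_ne_zero h
  have key : (y - x) * (y * (x + 1) + 1) * (y * x + (x + 1)) = 0 := by
    linear_combination x * (x + 1) * hy - y * (y + 1) * h
  rcases mul_eq_zero.1 key with key | key
  · rcases mul_eq_zero.1 key with key | key
    · exact Or.inl (by linear_combination key)
    · exact Or.inr (Or.inl (by field_simp; linear_combination key))
  · exact Or.inr (Or.inr (by field_simp; linear_combination key))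

/-- The denominator of the formulas is, up to sign, the cubic for `m` at `-1 - z`, so it vanishes
when `x + z + 1 = 0` for a root `x`. -/
theorem add_add_one_ne_zero_of_shanks (h : x ^ 3 - m * x ^ 2 - (m + 3) * x - 1 = 0)
    (hD : m * z * (z + 1) + z ^ 3 + 3 * z ^ 2 - 1 ≠ 0) : x + z + 1 ≠ 0 := by
  intro h1
  obtain rfl : z = -1 - x := by linear_combination h1
  exact hD (by linear_combination -h)

/-- The group product of a root for `m` with `z` is a root for the value of the first formula. -/
theorem shanks_root_mul (h : x ^ 3 - m * x ^ 2 - (m + 3) * x - 1 = 0)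
    (hD : m * z * (z + 1) + z ^ 3 + 3 * z ^ 2 - 1 ≠ 0)
    (hn : n = (m * (z ^ 3 - 3 * z - 1) - 9 * z * (z + 1)) /
      (m * z * (z + 1) + z ^ 3 + 3 * z ^ 2 - 1)) (hy : y = (x * z - 1) / (x + z + 1)) :
    y ^ 3 - n * y ^ 2 - (n + 3) * y - 1 = 0 := by
  have h1 := add_add_one_ne_zero_of_shanks h hD
  rw [eq_div_iff hD] at hn
  have key : (x * z - 1) ^ 3 - n * (x * z - 1) ^ 2 * (x + z + 1)
      - (n + 3) * (x * z - 1) * (x + z + 1) ^ 2 - (x + z + 1) ^ 3 = 0 := by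
    refine (mul_eq_zero.1 ?_).resolve_left hD
    linear_combination (-(x * z - 1) ^ 2 * (x + z + 1) - (x * z - 1) * (x + z + 1) ^ 2) * hn +
      (z ^ 2 + z + 1) ^ 3 * h
  subst hy
  field_simp
  linear_combination key

/-- If `z` is the group quotient `y ∗ (-1 - x)` of the root `y` for `n` by the root `x` for `m`,
then the first formula holds. -/
theorem shanks_formula_of_quotient (hx : x ^ 3 - m * x ^ 2 - (m + 3) * x - 1 = 0)
    (hy : y ^ 3 - n * y ^ 2 - (n + 3) * y - 1 = 0) (hx2 : x ^ 2 + x + 1 ≠ 0) (hyx : y ≠ x)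
    (hz : z = -(y * (x + 1) + 1) / (y - x)) :
    m * z * (z + 1) + z ^ 3 + 3 * z ^ 2 - 1 ≠ 0 ∧
      n = (m * (z ^ 3 - 3 * z - 1) - 9 * z * (z + 1)) /
        (m * z * (z + 1) + z ^ 3 + 3 * z ^ 2 - 1) := by
  have hx0 := shanks_root_ne_zero hx
  have hx1 := shanks_root_add_one_ne_zero hx
  have hy0 := shanks_root_ne_zero hy
  have hy1 := shanks_root_add_one_ne_zero hy
  have hd : y - x ≠ 0 := sub_ne_zero.2 hyx
  have hm : m = (x ^ 3 - 3 * x - 1) / (x * (x + 1)) := by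
    rw [eq_div_iff (mul_ne_zero hx0 hx1)]
    linear_combination -hx
  have hn : n = (y ^ 3 - 3 * y - 1) / (y * (y + 1)) := by
    rw [eq_div_iff (mul_ne_zero hy0 hy1)]
    linear_combination -hy
  have hD : m * z * (z + 1) + z ^ 3 + 3 * z ^ 2 - 1 =
      -((x ^ 2 + x + 1) ^ 3 * (y * (y + 1))) / ((y - x) ^ 3 * (x * (x + 1))) := by
    rw [hm, hz]
    field_simp
    ring
  have hD0 : m * z * (z + 1) + z ^ 3 + 3 * z ^ 2 - 1 ≠ 0 := by
    rw [hD]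
    exact div_ne_zero (neg_ne_zero.2 (mul_ne_zero (pow_ne_zero 3 hx2) (mul_ne_zero hy0 hy1)))
      (mul_ne_zero (pow_ne_zero 3 hd) (mul_ne_zero hx0 hx1))
  refine ⟨hD0, ?_⟩
  rw [eq_div_iff hD0, hD, hn, hm, hz]
  field_simp
  ring

/-- The second formula is the first one for the parameter `-n - 3`. -/
theorem shanks_second_formula_iff (hD : m * z * (z + 1) + z ^ 3 + 3 * z ^ 2 - 1 ≠ 0) :
    n = -((m * (z ^ 3 + 3 * z ^ 2 - 1) + 3 * (z ^ 3 - 3 * z - 1)) /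
        (m * z * (z + 1) + z ^ 3 + 3 * z ^ 2 - 1)) ↔
      -n - 3 = (m * (z ^ 3 - 3 * z - 1) - 9 * z * (z + 1)) /
        (m * z * (z + 1) + z ^ 3 + 3 * z ^ 2 - 1) := by
  rw [← neg_div, eq_div_iff hD, eq_div_iff hD]
  constructor <;> intro h <;> linear_combination -h

end Roots

/-! ### The splitting field -/

section SplittingField

variable {M : Type*} [Field M] {Ω : Type*} [Field Ω] [Algebra M Ω] {m n : M} {x y : Ω}

theorem aeval_shanksCubic (m : M) (x : Ω) : aeval x (shanksCubic m) =
    x ^ 3 - algebraMap M Ω m * x ^ 2 - (algebraMap M Ω m + 3) * x - 1 := by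
  simp [shanksCubic, map_ofNat]

theorem shanksCubic_monic_natDegree (m : M) :
    (shanksCubic m).Monic ∧ (shanksCubic m).natDegree = 3 := by
  have h : shanksCubic m = X ^ 3 + (C (-m) * X ^ 2 + C (-(m + 3)) * X + C (-1)) := by
    simp only [shanksCubic, C_neg, C_1]
    ring
  have hd : (C (-m) * X ^ 2 + C (-(m + 3)) * X + C (-1) : M[X]).degree < 3 :=
    degree_quadratic_lt
  rw [h]
  refine ⟨monic_X_pow_add hd, natDegree_eq_of_degree_eq_some ?_⟩
  rw [degree_add_eq_left_of_degree_lt] <;> rw [degree_X_pow]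
  exact hd

theorem mem_rootSet_shanksCubic : x ∈ (shanksCubic m).rootSet Ω ↔
    x ^ 3 - algebraMap M Ω m * x ^ 2 - (algebraMap M Ω m + 3) * x - 1 = 0 := by
  rw [mem_rootSet, aeval_shanksCubic]
  exact and_iff_right (shanksCubic_monic_natDegree m).1.ne_zero

theorem exists_shanks_root (Ω : Type*) [Field Ω] [Algebra M Ω] [IsAlgClosed Ω] (m : M) :
    ∃ x : Ω, x ^ 3 - algebraMap M Ω m * x ^ 2 - (algebraMap M Ω m + 3) * x - 1 = 0 := by
  obtain ⟨x, hx⟩ := IsAlgClosed.exists_aeval_eq_zero Ω (shanksCubic m) (by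
    rw [degree_eq_natDegree (shanksCubic_monic_natDegree m).1.ne_zero,
      (shanksCubic_monic_natDegree m).2]
    norm_num)
  exact ⟨x, by rwa [aeval_shanksCubic] at hx⟩

/-- A root fixed by the order-three map would be a double root. -/
theorem sq_add_add_one_ne_zero (hm : (shanksCubic m).Separable)
    (hx : x ^ 3 - algebraMap M Ω m * x ^ 2 - (algebraMap M Ω m + 3) * x - 1 = 0) :
    x ^ 2 + x + 1 ≠ 0 := by
  intro h
  refine hm.aeval_derivative_ne_zero (x := x) (by rwa [aeval_shanksCubic]) ?_
  have hd : aeval x (derivative (shanksCubic m)) =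
      3 * x ^ 2 - 2 * algebraMap M Ω m * x - (algebraMap M Ω m + 3) := by
    simp [shanksCubic, map_ofNat]
    ring
  rw [hd]
  linear_combination -(2 * x + 1) * hx + ((2 * x + 1) * (x - 1 - algebraMap M Ω m) - 3) * h

theorem splittingFieldIn_shanksCubic
    (hx : x ^ 3 - algebraMap M Ω m * x ^ 2 - (algebraMap M Ω m + 3) * x - 1 = 0) :
    splittingFieldIn Ω (shanksCubic m) = IntermediateField.adjoin M {x} := by
  apply le_antisymm
  · refine IntermediateField.adjoin_le_iff.2 fun y hy => ?_
    have hxm := IntermediateField.mem_adjoin_simple_self M x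
    rcases shanks_roots_eq hx (mem_rootSet_shanksCubic.1 hy) with rfl | rfl | rfl
    · exact hxm
    · exact div_mem (neg_mem (one_mem _)) (add_mem hxm (one_mem _))
    · exact div_mem (neg_mem (add_mem hxm (one_mem _))) hxm
  · exact IntermediateField.adjoin.mono _ _ _
      (Set.singleton_subset_iff.2 (mem_rootSet_shanksCubic.2 hx))

theorem splittingFieldIn_neg_sub_three [IsAlgClosed Ω] (n : M) :
    splittingFieldIn Ω (shanksCubic (-n - 3)) = splittingFieldIn Ω (shanksCubic n) := by
  obtain ⟨y, hy⟩ := exists_shanks_root Ω n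
  have hy' := shanks_root_inv hy
  rw [splittingFieldIn_shanksCubic hy,
    splittingFieldIn_shanksCubic (x := y⁻¹) (by simpa [map_ofNat] using hy')]
  apply le_antisymm <;> rw [IntermediateField.adjoin_simple_le_iff]
  · exact inv_mem (IntermediateField.mem_adjoin_simple_self M y)
  · simpa using inv_mem (IntermediateField.mem_adjoin_simple_self M y⁻¹)

theorem splittingFieldIn_eq_of_shanks_formula [IsAlgClosed Ω] {z : M}
    (hn : ∀ y : Ω, y ^ 3 - algebraMap M Ω n * y ^ 2 - (algebraMap M Ω n + 3) * y - 1 = 0 →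
      y ^ 2 + y + 1 ≠ 0)
    (hD : m * z * (z + 1) + z ^ 3 + 3 * z ^ 2 - 1 ≠ 0)
    (hz : n = (m * (z ^ 3 - 3 * z - 1) - 9 * z * (z + 1)) /
      (m * z * (z + 1) + z ^ 3 + 3 * z ^ 2 - 1)) :
    splittingFieldIn Ω (shanksCubic m) = splittingFieldIn Ω (shanksCubic n) := by
  obtain ⟨x, hx⟩ := exists_shanks_root Ω m
  set y : Ω := (x * algebraMap M Ω z - 1) / (x + algebraMap M Ω z + 1) with hydef
  have hD' := (map_ne_zero (algebraMap M Ω)).2 hD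
  have hz' := congrArg (algebraMap M Ω) hz
  simp only [map_add, map_sub, map_mul, map_pow, map_one, map_ofNat, map_div₀] at hD' hz'
  have hy := shanks_root_mul hx hD' hz' hydef
  have hxz := add_add_one_ne_zero_of_shanks hx hD'
  rw [eq_div_iff hxz] at hydef
  have hyz : y - algebraMap M Ω z ≠ 0 := by
    intro h
    rw [← sub_eq_zero.1 h] at hydef
    exact hn y hy (by linear_combination hydef)
  have hxy : x = -(y * (algebraMap M Ω z + 1) + 1) / (y - algebraMap M Ω z) := by
    rw [eq_div_iff hyz]
    linear_combination hydef
  rw [splittingFieldIn_shanksCubic hx, splittingFieldIn_shanksCubic hy]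
  apply le_antisymm <;> rw [IntermediateField.adjoin_simple_le_iff]
  · have hym := IntermediateField.mem_adjoin_simple_self M y
    have hzm := (IntermediateField.adjoin M {y}).algebraMap_mem z
    rw [hxy]
    exact div_mem (neg_mem (add_mem (mul_mem hym (add_mem hzm (one_mem _))) (one_mem _)))
      (sub_mem hym hzm)
  · have hxm := IntermediateField.mem_adjoin_simple_self M x
    have hzm := (IntermediateField.adjoin M {x}).algebraMap_mem z
    exact div_mem (sub_mem (mul_mem hxm hzm) (one_mem _))
      (add_mem (add_mem hxm hzm) (one_mem _))

end SplittingField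

/-! ### Descent of the quotient of two roots -/

section Descent

variable {M : Type*} [Field M] {Ω : Type*} [Field Ω] [Algebra M Ω] {m n : M} {x y z : Ω}

theorem algEquiv_fixes_of_mem_adjoin_simple {τ : Ω ≃ₐ[M] Ω} (hz : τ z = z)
    (hx : x ∈ IntermediateField.adjoin M {z}) : τ x = x := by
  induction hx using IntermediateField.adjoin_induction with
  | mem w hw => rwa [Set.mem_singleton_iff.1 hw]
  | algebraMap w => exact τ.commutes w
  | add a b _ _ ha hb => rw [map_add, ha, hb]
  | inv a _ ha => rw [map_inv₀, ha]
  | mul a b _ _ ha hb => rw [map_mul, ha, hb]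

/-- A root in the base field would bring `x` with it, since the roots are rational in each other;
and a cubic without a root in the base field is irreducible. -/
theorem minpoly_eq_shanksCubic
    (hx : x ^ 3 - algebraMap M Ω m * x ^ 2 - (algebraMap M Ω m + 3) * x - 1 = 0)
    (hxM : x ∉ (algebraMap M Ω).range) : minpoly M x = shanksCubic m := by
  have hmd := shanksCubic_monic_natDegree m
  refine (minpoly.eq_of_irreducible_of_monic ?_ (by rwa [aeval_shanksCubic]) hmd.1).symm
  refine irreducible_of_degree_le_three_of_not_isRoot (by simp [hmd.2]) fun t ht => hxM ?_
  have ht' := congrArg (algebraMap M Ω) ht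
  rw [← aeval_algebraMap_apply_eq_algebraMap_eval, map_zero, aeval_shanksCubic] at ht'
  rcases shanks_roots_eq ht' hx with rfl | rfl | rfl
  · exact ⟨t, rfl⟩
  · exact ⟨-1 / (t + 1), by simp⟩
  · exact ⟨-(t + 1) / t, by simp⟩

/-- A field of prime degree has no proper intermediate field, so an element fixed by an automorphism
that moves the generator lies in the base field. -/
theorem mem_range_of_fixed_of_shanks [Algebra.IsAlgebraic M Ω]
    (hx : x ^ 3 - algebraMap M Ω m * x ^ 2 - (algebraMap M Ω m + 3) * x - 1 = 0)
    (hxM : x ∉ (algebraMap M Ω).range) {τ : Ω ≃ₐ[M] Ω} (hτ : τ x ≠ x) (hz : τ z = z)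
    (hzx : z ∈ IntermediateField.adjoin M {x}) : z ∈ (algebraMap M Ω).range := by
  have hxi : IsIntegral M x := Algebra.IsIntegral.isIntegral x
  have h3 : Module.finrank M (IntermediateField.adjoin M {x}) = 3 := by
    rw [IntermediateField.adjoin.finrank hxi, minpoly_eq_shanksCubic hx hxM,
      (shanksCubic_monic_natDegree m).2]
  have hle : IntermediateField.adjoin M {z} ≤ IntermediateField.adjoin M {x} :=
    IntermediateField.adjoin_simple_le_iff.2 hzx
  have := IntermediateField.adjoin.finiteDimensional hxi
  have hdvd := IntermediateField.finrank_dvd_of_le_right hle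
  rw [h3] at hdvd
  rcases (Nat.dvd_prime Nat.prime_three).1 hdvd with h | h
  · exact IntermediateField.mem_bot.1 (IntermediateField.finrank_adjoin_simple_eq_one_iff.1 h)
  · have heq := IntermediateField.eq_of_le_of_finrank_eq hle (h.trans h3.symm)
    exact absurd (algEquiv_fixes_of_mem_adjoin_simple hz
      (heq ▸ IntermediateField.mem_adjoin_simple_self M x)) hτ

theorem exists_shanks_formula_of_quotient_mem_range
    (hx : x ^ 3 - algebraMap M Ω m * x ^ 2 - (algebraMap M Ω m + 3) * x - 1 = 0)
    (hy : y ^ 3 - algebraMap M Ω n * y ^ 2 - (algebraMap M Ω n + 3) * y - 1 = 0)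
    (hx2 : x ^ 2 + x + 1 ≠ 0)
    (hz : -(y * (x + 1) + 1) / (y - x) ∈ (algebraMap M Ω).range) :
    ∃ z : M, m * z * (z + 1) + z ^ 3 + 3 * z ^ 2 - 1 ≠ 0 ∧
      n = (m * (z ^ 3 - 3 * z - 1) - 9 * z * (z + 1)) /
        (m * z * (z + 1) + z ^ 3 + 3 * z ^ 2 - 1) := by
  by_cases hyx : y = x
  · -- The quotient is the unit `∞`; its translate `0` gives the same formula.
    refine ⟨0, by simp, ?_⟩
    subst hyx
    have h : y * (y + 1) * (algebraMap M Ω n - algebraMap M Ω m) = 0 := by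
      linear_combination hx - hy
    have h' := (mul_eq_zero.1 h).resolve_left
      (mul_ne_zero (shanks_root_ne_zero hx) (shanks_root_add_one_ne_zero hx))
    simpa using (algebraMap M Ω).injective (sub_eq_zero.1 h')
  · obtain ⟨z, hz⟩ := hz
    obtain ⟨hD, hn⟩ := shanks_formula_of_quotient hx hy hx2 hyx hz
    refine ⟨z, fun h => hD ?_, (algebraMap M Ω).injective ?_⟩
    · simpa [map_ofNat] using congrArg (algebraMap M Ω) h
    · simpa [map_ofNat] using hn

/-- An automorphism acting on both roots by the order-three map fixes their quotient, because
that map is a translation of the group. -/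
theorem map_shanks_quotient {τ : Ω ≃ₐ[M] Ω} (hx1 : x + 1 ≠ 0) (hy1 : y + 1 ≠ 0)
    (hx : τ x = -1 / (x + 1)) (hy : τ y = -1 / (y + 1)) :
    τ (-(y * (x + 1) + 1) / (y - x)) = -(y * (x + 1) + 1) / (y - x) := by
  rcases eq_or_ne y x with rfl | hyx
  · simp
  have hd : y - x ≠ 0 := sub_ne_zero.2 hyx
  have hd' : -1 / (y + 1) - -1 / (x + 1) ≠ 0 := by
    rw [← hx, ← hy, ← map_sub]
    exact (map_ne_zero τ).2 hd
  rw [map_div₀, map_neg, map_add, map_mul, map_add, map_sub, map_one, hx, hy,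
    div_eq_div_iff hd' hd]
  field_simp
  ring

theorem exists_shanks_formula_of_adjoin_eq [IsAlgClosure M Ω]
    (hx : x ^ 3 - algebraMap M Ω m * x ^ 2 - (algebraMap M Ω m + 3) * x - 1 = 0)
    (hy : y ^ 3 - algebraMap M Ω n * y ^ 2 - (algebraMap M Ω n + 3) * y - 1 = 0)
    (hx2 : x ^ 2 + x + 1 ≠ 0)
    (h : IntermediateField.adjoin M {x} = IntermediateField.adjoin M {y}) :
    ∃ z : M, m * z * (z + 1) + z ^ 3 + 3 * z ^ 2 - 1 ≠ 0 ∧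
      (n = (m * (z ^ 3 - 3 * z - 1) - 9 * z * (z + 1)) /
          (m * z * (z + 1) + z ^ 3 + 3 * z ^ 2 - 1) ∨
        -n - 3 = (m * (z ^ 3 - 3 * z - 1) - 9 * z * (z + 1)) /
          (m * z * (z + 1) + z ^ 3 + 3 * z ^ 2 - 1)) := by
  have : Algebra.IsAlgebraic M Ω := IsAlgClosure.isAlgebraic
  have : Normal M Ω := IsAlgClosure.normal M Ω
  have hx1 := shanks_root_add_one_ne_zero hx
  have hy0 := shanks_root_ne_zero hy
  have hy1 := shanks_root_add_one_ne_zero hy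
  have hxm := IntermediateField.mem_adjoin_simple_self M x
  have hym : y ∈ IntermediateField.adjoin M {x} :=
    h ▸ IntermediateField.mem_adjoin_simple_self M y
  have hmem : ∀ w ∈ IntermediateField.adjoin M {x},
      -(w * (x + 1) + 1) / (w - x) ∈ IntermediateField.adjoin M {x} := fun w hw =>
    div_mem (neg_mem (add_mem (mul_mem hw (add_mem hxm (one_mem _))) (one_mem _)))
      (sub_mem hw hxm)
  by_cases hxM : x ∈ (algebraMap M Ω).range
  · -- Both fields are the base field, which then contains every quotient.
    have hbot : IntermediateField.adjoin M {x} = ⊥ :=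
      IntermediateField.adjoin_simple_eq_bot_iff.2 (IntermediateField.mem_bot.2 hxM)
    obtain ⟨z, hD, hz⟩ := exists_shanks_formula_of_quotient_mem_range hx hy hx2
      (IntermediateField.mem_bot.1 (hbot ▸ hmem y hym))
    exact ⟨z, hD, Or.inl hz⟩
  obtain ⟨τ, hτ⟩ : ∃ τ : Ω ≃ₐ[M] Ω, τ x = -1 / (x + 1) := by
    have hconj : IsConjRoot M (-1 / (x + 1)) x := by
      refine (isConjRoot_of_aeval_eq_zero (Algebra.IsIntegral.isIntegral x) ?_).symm
      rw [minpoly_eq_shanksCubic hx hxM, aeval_shanksCubic]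
      exact shanks_root_rotate hx
    exact isConjRoot_iff_exists_algEquiv.1 hconj
  have hτx : τ x ≠ x := by
    rw [hτ, ne_eq, div_eq_iff hx1]
    exact fun e => hx2 (by linear_combination -e)
  have hτroot : (τ y) ^ 3 - algebraMap M Ω n * (τ y) ^ 2 - (algebraMap M Ω n + 3) * τ y - 1
      = 0 := by
    simpa [map_ofNat] using congrArg τ hy
  rcases shanks_roots_eq hy hτroot with hτy | hτy | hτy
  · exact absurd (algEquiv_fixes_of_mem_adjoin_simple hτy (h ▸ hxm)) hτx
  · obtain ⟨z, hD, hz⟩ := exists_shanks_formula_of_quotient_mem_range hx hy hx2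
      (mem_range_of_fixed_of_shanks hx hxM hτx (map_shanks_quotient hx1 hy1 hτ hτy) (hmem y hym))
    exact ⟨z, hD, Or.inl hz⟩
  · have hy' := shanks_root_inv hy
    have hτy' : τ y⁻¹ = -1 / (y⁻¹ + 1) := by
      rw [map_inv₀, hτy, eq_div_iff (shanks_root_add_one_ne_zero hy')]
      field_simp
      ring
    obtain ⟨z, hD, hz⟩ := exists_shanks_formula_of_quotient_mem_range (n := -n - 3) hx
      (by simpa [map_ofNat] using hy') hx2 (mem_range_of_fixed_of_shanks hx hxM hτx
        (map_shanks_quotient hx1 (shanks_root_add_one_ne_zero hy') hτ hτy')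
        (hmem _ (inv_mem hym)))
    exact ⟨z, hD, Or.inr hz⟩

end Descent

theorem theorem5p2 {M : Type*} [Field M] (hchar : ringChar M ≠ 2)
    (Ω : Type*) [Field Ω] [Algebra M Ω] [IsAlgClosure M Ω]
    (m n : M) (hm : (shanksCubic m).Separable) (hn : (shanksCubic n).Separable) :
    splittingFieldIn Ω (shanksCubic m) = splittingFieldIn Ω (shanksCubic n) ↔
      ∃ z : M, m * z * (z + 1) + z ^ 3 + 3 * z ^ 2 - 1 ≠ 0 ∧
        (n = (m * (z ^ 3 - 3 * z - 1) - 9 * z * (z + 1)) /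
            (m * z * (z + 1) + z ^ 3 + 3 * z ^ 2 - 1) ∨
          n = -((m * (z ^ 3 + 3 * z ^ 2 - 1) + 3 * (z ^ 3 - 3 * z - 1)) /
            (m * z * (z + 1) + z ^ 3 + 3 * z ^ 2 - 1))) := by
  have : IsAlgClosed Ω := IsAlgClosure.isAlgClosed M
  constructor
  · intro h
    obtain ⟨x, hx⟩ := exists_shanks_root Ω m
    obtain ⟨y, hy⟩ := exists_shanks_root Ω n
    rw [splittingFieldIn_shanksCubic hx, splittingFieldIn_shanksCubic hy] at h
    obtain ⟨z, hD, hz⟩ :=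
      exists_shanks_formula_of_adjoin_eq hx hy (sq_add_add_one_ne_zero hm hx) h
    exact ⟨z, hD, hz.imp_right (shanks_second_formula_iff hD).2⟩
  · rintro ⟨z, hD, hz | hz⟩
    · exact splittingFieldIn_eq_of_shanks_formula (fun y hy => sq_add_add_one_ne_zero hn hy) hD hz
    · rw [← splittingFieldIn_neg_sub_three n]
      refine splittingFieldIn_eq_of_shanks_formula (fun y hy h2 => ?_) hD
        ((shanks_second_formula_iff hD).1 hz)
      have h0 := shanks_root_ne_zero hy
      refine sq_add_add_one_ne_zero hn (x := y⁻¹) ?_ ?_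
      · simpa [map_ofNat] using shanks_root_inv hy
      · field_simp
        linear_combination h2
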